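/- Let $T$ be $\{0,1,\dots,N\}$ or $[0,\infty)$ (more generally, a linearly ordered set with least element $0$), and let $\mathbb X=(X_t)_{t\in T}$ be a filtration by subcomplexes of a finite (simplicial, cubical or cell) complex: $X_s\subset X_t$ for $s\le t$, and $X_0=\emptyset$. A finite cell complex is understood combinatorially: it is a finite set of cells with dimensions and integral incidence numbers $[\sigma:\tau]$, which vanish unless $\dim\sigma=\dim\tau+1$, such that the boundary map $\partial\sigma=\sum_\tau[\sigma:\tau]\,\tau$ satisfies $\partial\partial=0$; a subcomplex is a set of cells that contains, with a cell $\sigma$, every $\tau$ with $[\sigma:\tau]\neq0$; homology is that of the cellular chain complex, and relative homology $H_q(X_n,X_m;\mathbb Z)$ is the homology of the quotient of the chain complex of $X_n$ by that of $X_m$. For a field $\Bbbk$, the $q$-th persistence diagram $D_q(\mathbb X;\Bbbk)$ is the finite multiset of pairs $(b,d)$, $0<b<d\le\infty$, such that the system $(H_q(X_t;\Bbbk))_{t\in T}$, with the maps induced by the inclusions, is isomorphic to $\bigoplus_{(b,d)\in D_q(\mathbb X;\Bbbk)}I(b,d)$; here $I(b,d)$ is $\Bbbk$ at the times $t$ with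 $b\le t<d$ and $0$ at all others, with identity maps between the times in $[b,d)$ and zero maps otherwise. Fix $q$. Suppose that 1. $D_q(\mathbb X;\Bbbk)$ is independent of the choice of the field $\Bbbk$ among $\mathbb C$, $\mathbb R$, $\mathbb Q$ and $\mathbb Z/p$ for all primes $p$, that is, one multiset of pairs is the $q$-th persistence diagram over each of these fields; and 2. $H_{q-1}(X_n;\mathbb Z)$ is a free abelian group for every $n\in T$ (where $H_{-1}=0$). Then $H_q(X_n,X_m;\mathbb Z)$ is a free abelian group for all $m<n$ in $T$. -/

import Mathlib

open CategoryTheory CategoryTheory.Limits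

universe u v w

/-- A finite cell complex, given by its finite set `K` of cells: every cell has a dimension, and any
two cells have an integral incidence number `[σ : τ]`, the coefficient of `τ` in the boundary of
`σ`. Incidence numbers vanish unless `dim σ = dim τ + 1`, and the boundary of a boundary is zero.

Finite simplicial complexes (with oriented simplices), finite cubical complexes and finite
CW complexes (incidence number = degree of the attaching map of `σ` over `τ`) are of this kind,
and the homology defined below is simplicial, cubical and cellular homology respectively. -/
structure CellComplex (K : Type u) [Fintype K] where
  /-- The dimension of a cell. -/
  dim : K → ℕ
  /-- The incidence number `[σ : τ]`. -/
  incidence : K → K → ℤ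
  dim_eq_of_incidence_ne_zero : ∀ σ τ, incidence σ τ ≠ 0 → dim σ = dim τ + 1
  boundary_boundary : ∀ σ ρ, ∑ τ, incidence σ τ * incidence τ ρ = 0

namespace CellComplex

variable {K : Type u} [Fintype K]

/-- A subcomplex: a set of cells containing, with a cell, all cells that occur in its boundary. -/
@[ext]
structure Subcomplex (C : CellComplex K) where
  /-- The cells of the subcomplex. -/
  carrier : Set K
  mem_of_incidence_ne_zero : ∀ σ τ, σ ∈ carrier → C.incidence σ τ ≠ 0 → τ ∈ carrier

instance (C : CellComplex K) : PartialOrder C.Subcomplex :=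
  PartialOrder.lift Subcomplex.carrier (fun _ _ h => Subcomplex.ext h)

/-- The cells of dimension `q` of a subcomplex (none if `q` is negative). -/
abbrev CellsOfDim (C : CellComplex K) (A : C.Subcomplex) (q : ℤ) : Type u :=
  {σ : K // σ ∈ A.carrier ∧ (C.dim σ : ℤ) = q}

noncomputable section

/-- The boundary map `C_i(A; R) → C_j(A; R)`, `σ ↦ ∑ τ, [σ : τ] τ`, between free modules on cells.
It is zero unless `i = j + 1`. -/
def boundary (C : CellComplex K) (R : Type v) [CommRing R] (A : C.Subcomplex) (i j : ℤ) :
    (C.CellsOfDim A i →₀ R) →ₗ[R] (C.CellsOfDim A j →₀ R) :=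
  Finsupp.linearCombination R
    (fun σ => Finsupp.equivFunOnFinite.symm (fun τ => (C.incidence σ.1 τ.1 : R)))

lemma boundary_single_apply (C : CellComplex K) (R : Type v) [CommRing R] (A : C.Subcomplex)
    (i j : ℤ) (σ : C.CellsOfDim A i) (r : R) (τ : C.CellsOfDim A j) :
    C.boundary R A i j (Finsupp.single σ r) τ = r * (C.incidence σ.1 τ.1 : R) := by
  simp [boundary]

lemma boundary_eq_zero (C : CellComplex K) (R : Type v) [CommRing R] (A : C.Subcomplex)
    (i j : ℤ) (h : j + 1 ≠ i) : C.boundary R A i j = 0 := by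
  ext σ τ
  simp only [LinearMap.comp_apply, Finsupp.lsingle_apply, boundary_single_apply]
  have : C.incidence σ.1 τ.1 = 0 := by
    by_contra h0
    have h1 := C.dim_eq_of_incidence_ne_zero _ _ h0
    have h2 := σ.2.2
    have h3 := τ.2.2
    omega
  simp [this]

lemma boundary_comp_boundary (C : CellComplex K) (R : Type v) [CommRing R] (A : C.Subcomplex)
    (i j k : ℤ) (hij : j + 1 = i) : C.boundary R A j k ∘ₗ C.boundary R A i j = 0 := by
  classical
  ext σ ρ
  have hb : C.boundary R A i j (Finsupp.single σ 1) =
      ∑ τ : C.CellsOfDim A j, Finsupp.single τ (C.incidence σ.1 τ.1 : R) := by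
    ext τ
    rw [boundary_single_apply, Finsupp.finsetSum_apply]
    simp [Finsupp.single_apply]
  simp only [LinearMap.comp_apply, Finsupp.lsingle_apply, hb, map_sum, Finsupp.finsetSum_apply,
    boundary_single_apply, LinearMap.zero_apply, Finsupp.zero_apply]
  have h1 : ∑ τ : C.CellsOfDim A j, C.incidence σ.1 τ.1 * C.incidence τ.1 ρ.1 =
      ∑ τ, C.incidence σ.1 τ * C.incidence τ ρ.1 := by
    refine Fintype.sum_of_injective Subtype.val Subtype.val_injective _ _ ?_ (fun _ => rfl)
    intro τ hτ
    by_cases h0 : C.incidence σ.1 τ = 0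
    · simp [h0]
    · refine (hτ ⟨⟨τ, A.mem_of_incidence_ne_zero _ _ σ.2.1 h0, ?_⟩, rfl⟩).elim
      have h1 := C.dim_eq_of_incidence_ne_zero _ _ h0
      have h2 := σ.2.2
      omega
  rw [C.boundary_boundary] at h1
  exact_mod_cast congrArg (Int.cast : ℤ → R) h1

/-- The cellular chain complex `C_•(A; R)`. -/
def chains (C : CellComplex K) (R : Type v) [CommRing R] (A : C.Subcomplex) :
    ChainComplex (ModuleCat.{max u v} R) ℤ where
  X q := ModuleCat.of R (C.CellsOfDim A q →₀ R)
  d i j := ModuleCat.ofHom (C.boundary R A i j)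
  shape i j h := by
    rw [C.boundary_eq_zero R A i j h]
    rfl
  d_comp_d' i j k hij _ := by
    rw [← ModuleCat.ofHom_comp, C.boundary_comp_boundary R A i j k hij]
    rfl

/-- For `A ≤ B`, the inclusion of the `q`-cells of `A` into the `q`-cells of `B`. -/
def cellsInclusion (C : CellComplex K) {A B : C.Subcomplex} (h : A ≤ B) (q : ℤ) :
    C.CellsOfDim A q → C.CellsOfDim B q :=
  fun σ => ⟨σ.1, h σ.2.1, σ.2.2⟩

lemma boundary_lmapDomain (C : CellComplex K) (R : Type v) [CommRing R] {A B : C.Subcomplex}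
    (h : A ≤ B) (i j : ℤ) :
    C.boundary R B i j ∘ₗ Finsupp.lmapDomain R R (C.cellsInclusion h i) =
      Finsupp.lmapDomain R R (C.cellsInclusion h j) ∘ₗ C.boundary R A i j := by
  classical
  ext σ τ
  have hinj : Function.Injective (C.cellsInclusion h j) := fun a b hab =>
    Subtype.ext (congrArg (fun x => x.1) hab)
  simp only [LinearMap.comp_apply, Finsupp.lsingle_apply, Finsupp.lmapDomain_apply,
    Finsupp.mapDomain_single, boundary_single_apply]
  by_cases hτ : τ.1 ∈ A.carrier
  · have : τ = C.cellsInclusion h j ⟨τ.1, hτ, τ.2.2⟩ := rfl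
    rw [this, Finsupp.mapDomain_apply hinj, boundary_single_apply]
    rfl
  · rw [Finsupp.mapDomain_of_notMem_range]
    · have : C.incidence σ.1 τ.1 = 0 := by
        by_contra h0
        exact hτ (A.mem_of_incidence_ne_zero _ _ σ.2.1 h0)
      simp [cellsInclusion, this]
    · rintro ⟨x, rfl⟩
      exact hτ x.2.1

/-- For `A ≤ B`, the chain map `C_•(A; R) → C_•(B; R)` induced by the inclusion. -/
def chainsMap (C : CellComplex K) (R : Type v) [CommRing R] {A B : C.Subcomplex} (h : A ≤ B) :
    C.chains R A ⟶ C.chains R B where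
  f q := ModuleCat.ofHom (Finsupp.lmapDomain R R (C.cellsInclusion h q))
  comm' i j _ := by
    simp only [chains, ← ModuleCat.ofHom_comp]
    rw [C.boundary_lmapDomain R h i j]

/-- The homology `H_q(A; R)`. -/
abbrev homology (C : CellComplex K) (R : Type v) [CommRing R] (A : C.Subcomplex) (q : ℤ) :
    ModuleCat.{max u v} R :=
  (C.chains R A).homology q

/-- For `A ≤ B`, the map `H_q(A; R) → H_q(B; R)` induced by the inclusion. -/
abbrev homologyMap (C : CellComplex K) (R : Type v) [CommRing R] {A B : C.Subcomplex}
    (h : A ≤ B) (q : ℤ) : C.homology R A q ⟶ C.homology R B q :=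
  HomologicalComplex.homologyMap (C.chainsMap R h) q

/-- For `A ≤ B`, the relative homology `H_q(B, A; R)`: the homology of the quotient complex
`C_•(B; R) / C_•(A; R)`. -/
abbrev relativeHomology (C : CellComplex K) (R : Type v) [CommRing R] {A B : C.Subcomplex}
    (h : A ≤ B) (q : ℤ) : ModuleCat.{max u v} R :=
  (cokernel (C.chainsMap R h)).homology q

/-- A filtration of a cell complex by subcomplexes, indexed by a linear order `T` with a least
element, starting with the empty complex. The main cases are `T = {0, …, N}` and
`T = [0, ∞)`. -/
structure Filtration (C : CellComplex K) (T : Type w) [LinearOrder T] [OrderBot T] where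
  /-- The subcomplex at time `t`. -/
  X : T → C.Subcomplex
  mono : Monotone X
  carrier_bot : (X ⊥).carrier = ∅

end

end CellComplex

noncomputable section

open Classical in
/-- The space at time `t` of the interval persistence module `I(b, d)` over `k`:
it is `k` if `b ≤ t < d` and `0` otherwise. -/
def intervalSpace (k : Type v) [Field k] {T : Type w} [LinearOrder T] (b : T) (d : WithTop T)
    (t : T) : Submodule k k :=
  if b ≤ t ∧ (t : WithTop T) < d then ⊤ else ⊥

open Classical in
/-- The structure map from time `s` to time `t` of the interval persistence module `I(b, d)`:
it is the identity of `k` if `b ≤ s ≤ t < d` and zero otherwise. -/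
def intervalMap (k : Type v) [Field k] {T : Type w} [LinearOrder T] (b : T) (d : WithTop T)
    (s t : T) : intervalSpace k b d s →ₗ[k] intervalSpace k b d t :=
  if h : b ≤ s ∧ s ≤ t ∧ (t : WithTop T) < d then
    Submodule.inclusion
      (le_top.trans_eq (if_pos (c := b ≤ t ∧ (t : WithTop T) < d) ⟨h.1.trans h.2.1, h.2.2⟩).symm)
  else 0

namespace CellComplex

variable {K : Type u} [Fintype K]

/-- `D` is the `q`-th persistence diagram of the filtration `F` with coefficients in the field `k`:
the persistence module `(H_q(X_t; k))_t` is isomorphic to the (finite) direct sum of the interval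
modules `I(b, d)` where `(b, d)` runs through the multiset `D` of birth-death pairs. -/
def IsPersistenceDiagram {C : CellComplex K} {T : Type w} [LinearOrder T] [OrderBot T]
    (F : C.Filtration T) (q : ℤ) (k : Type v) [Field k] (D : Multiset (T × WithTop T)) : Prop :=
  ∃ (L : ℕ) (b : Fin L → T) (d : Fin L → WithTop T),
    D = Finset.univ.val.map (fun i => (b i, d i)) ∧
    (∀ i, ⊥ < b i ∧ (b i : WithTop T) < d i) ∧
    ∃ e : ∀ t, C.homology k (F.X t) q ≃ₗ[k] (∀ i, intervalSpace k (b i) (d i) t),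
      ∀ (s t : T) (hst : s ≤ t) (x : C.homology k (F.X s) q) (i : Fin L),
        e t ((C.homologyMap k (F.mono hst) q).hom x) i =
          intervalMap k (b i) (d i) s t (e s x i)

/-- The `q`-th persistence diagram is independent of the choice of the coefficient field among
`ℂ`, `ℝ`, `ℚ` and the prime fields `ℤ/p`: one multiset `D` is the diagram over all of them. -/
def DiagramIndependentOfField {C : CellComplex K} {T : Type w} [LinearOrder T] [OrderBot T]
    (F : C.Filtration T) (q : ℤ) : Prop :=
  ∃ D : Multiset (T × WithTop T),
    IsPersistenceDiagram F q ℂ D ∧ IsPersistenceDiagram F q ℝ D ∧ IsPersistenceDiagram F q ℚ D ∧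
    ∀ (p : ℕ) [Fact p.Prime], IsPersistenceDiagram F q (ZMod p) D

end CellComplex

end

/-! Put `A = X_m`, `B = X_n`, and let `G` be the cokernel of `H_q(A; ℤ) → H_q(B; ℤ)`. The long exact
sequence makes `H_q(B, A; ℤ)` an extension of a subgroup of the free group `H_{q-1}(A; ℤ)` by `G`.
It is finitely generated, so it is free once `G` has no `p`-torsion for any prime `p`.

Over a field, the dimension of the analogous cokernel is the number of diagram points with `m < b ≤
n < d` (`IsPersistenceDiagram.finrank_homologyCoker`), hence the same over `ℚ` and `ℤ/p`. Over `ℚ`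
this is the rank of `G`. Over `ℤ/p` it is the dimension of `G/pG`, because freeness of `H_{q-1}`
lifts cycles mod `p` to integral cycles (`intCastCycles_zmod_surjective`). Equality of the two
numbers excludes `p`-torsion (`mem_of_prime_smul_mem`). The comparison is made on integral cycles,
without tensor products. -/

theorem LinearMap.eq_zero_of_map_smul_eq_zero {R M N : Type*} [CommRing R] [IsDomain R]
    [AddCommGroup M] [Module R M] [AddCommGroup N] [Module R N] [Module.IsTorsionFree R N]
    (f : M →ₗ[R] N) {r : R} (hr : r ≠ 0) {x : M} (h : f (r • x) = 0) : f x = 0 := by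
  rw [map_smul] at h
  exact (smul_eq_zero.mp h).resolve_left hr

/-! ### Homology classes of explicit cycles -/

namespace HomologicalComplex

variable {R : Type v} [CommRing R] {ι : Type*} {c : ComplexShape ι}

/-- The inclusion of the kernel of the differential into the cycles. -/
noncomputable def kerToCycles (S : HomologicalComplex (ModuleCat.{w} R) c) (i j : ι)
    (hj : c.next i = j) : ModuleCat.of R (LinearMap.ker (S.d i j).hom) ⟶ S.cycles i :=
  S.liftCycles (ModuleCat.ofHom (LinearMap.ker (S.d i j).hom).subtype) j hj (by ext x; exact x.2)

theorem iCycles_kerToCycles (S : HomologicalComplex (ModuleCat.{w} R) c) (i j : ι)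
    (hj : c.next i = j) (z : LinearMap.ker (S.d i j).hom) :
    (S.iCycles i).hom ((S.kerToCycles i j hj).hom z) = z.1 := by
  rw [← ModuleCat.comp_apply, kerToCycles, liftCycles_i]
  rfl

theorem iCycles_injective (S : HomologicalComplex (ModuleCat.{w} R) c) (i : ι) :
    Function.Injective (S.iCycles i).hom :=
  (ModuleCat.mono_iff_injective (S.iCycles i)).mp inferInstance

/-- The homology class of a cycle, for a complex of modules. -/
noncomputable def homologyClass (S : HomologicalComplex (ModuleCat.{w} R) c) (i j : ι)
    (hj : c.next i = j) : LinearMap.ker (S.d i j).hom →ₗ[R] S.homology i :=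
  (S.homologyπ i).hom ∘ₗ (S.kerToCycles i j hj).hom

theorem homologyClass_surjective (S : HomologicalComplex (ModuleCat.{w} R) c) (i j : ι)
    (hj : c.next i = j) : Function.Surjective (S.homologyClass i j hj) := by
  intro y
  obtain ⟨z, rfl⟩ := (ModuleCat.epi_iff_surjective (S.homologyπ i)).mp inferInstance y
  have hz : (S.d i j).hom ((S.iCycles i).hom z) = 0 := by
    rw [← ModuleCat.comp_apply, S.iCycles_d]
    rfl
  exact ⟨⟨(S.iCycles i).hom z, hz⟩, congrArg (S.homologyπ i).hom
    (S.iCycles_injective i (S.iCycles_kerToCycles i j hj _))⟩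

/-- The neighbouring degrees are variables tied by equations, so that `q + 1` and `q - 1` can
replace `c.prev q` and `c.next q`. -/
theorem homologyClass_eq_zero_iff (S : HomologicalComplex (ModuleCat.{w} R) c) (h i j : ι)
    (hj : c.next i = j) (hi : c.prev i = h) (z : LinearMap.ker (S.d i j).hom) :
    S.homologyClass i j hj z = 0 ↔ ∃ y, (S.d h i).hom y = z.1 := by
  have hexact : (ShortComplex.mk _ _ (S.toCycles_comp_homologyπ h i)).Exact :=
    ShortComplex.exact_of_g_is_cokernel _ (S.homologyIsCokernel h i hi)
  rw [homologyClass, LinearMap.comp_apply]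
  constructor
  · intro hz
    obtain ⟨y, hy⟩ := (ShortComplex.moduleCat_exact_iff _).mp hexact _ hz
    refine ⟨y, ?_⟩
    rw [← S.iCycles_kerToCycles i j hj, ← S.toCycles_i h i, ModuleCat.comp_apply]
    exact congrArg (S.iCycles i).hom hy
  · rintro ⟨y, hy⟩
    rw [← S.toCycles_i h i, ModuleCat.comp_apply, ← S.iCycles_kerToCycles i j hj] at hy
    rw [← S.iCycles_injective i hy]
    exact ShortComplex.moduleCat_zero_apply (ShortComplex.mk _ _ (S.toCycles_comp_homologyπ h i)) y

theorem homologyMap_homologyClass {S S' : HomologicalComplex (ModuleCat.{w} R) c} (φ : S ⟶ S')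
    (i j : ι) (hj : c.next i = j) (z : LinearMap.ker (S.d i j).hom)
    (z' : LinearMap.ker (S'.d i j).hom) (hz : (φ.f i).hom z.1 = z'.1) :
    (homologyMap φ i).hom (S.homologyClass i j hj z) = S'.homologyClass i j hj z' := by
  rw [homologyClass, homologyClass, LinearMap.comp_apply, LinearMap.comp_apply,
    ← ModuleCat.comp_apply (S.homologyπ i), homologyπ_naturality, ModuleCat.comp_apply]
  congr 1
  apply S'.iCycles_injective i
  rw [← ModuleCat.comp_apply, cyclesMap_i, ModuleCat.comp_apply, iCycles_kerToCycles,
    iCycles_kerToCycles]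
  exact hz

end HomologicalComplex

namespace CellComplex

variable {K : Type u} [Fintype K]

/-- The cycles of dimension `q` of a subcomplex. -/
noncomputable abbrev cycles (C : CellComplex K) (R : Type v) [CommRing R] (A : C.Subcomplex) (q : ℤ) :
    Submodule R (C.CellsOfDim A q →₀ R) :=
  LinearMap.ker (C.boundary R A q (q - 1))

/-- The homology class of a cycle. -/
noncomputable def homologyClass (C : CellComplex K) (R : Type v) [CommRing R] (A : C.Subcomplex)
    (q : ℤ) : C.cycles R A q →ₗ[R] C.homology R A q :=
  (C.chains R A).homologyClass q (q - 1) (ChainComplex.next _ _)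

theorem homologyClass_surjective (C : CellComplex K) (R : Type v) [CommRing R] (A : C.Subcomplex)
    (q : ℤ) : Function.Surjective (C.homologyClass R A q) :=
  (C.chains R A).homologyClass_surjective q (q - 1) (ChainComplex.next _ _)

theorem homologyClass_eq_zero_iff (C : CellComplex K) (R : Type v) [CommRing R] (A : C.Subcomplex)
    (q : ℤ) (z : C.cycles R A q) :
    C.homologyClass R A q z = 0 ↔ ∃ y, C.boundary R A (q + 1) q y = z.1 :=
  (C.chains R A).homologyClass_eq_zero_iff (q + 1) q (q - 1) _ (ChainComplex.prev _ _) z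

instance (C : CellComplex K) (A : C.Subcomplex) (q : ℤ) : Finite (C.CellsOfDim A q) :=
  Subtype.finite

theorem finite_homology (C : CellComplex K) (R : Type v) [CommRing R] [IsNoetherianRing R]
    (A : C.Subcomplex) (q : ℤ) : Module.Finite R (C.homology R A q) :=
  Module.Finite.of_surjective _ (C.homologyClass_surjective R A q)

/-- The inclusion of chains. -/
noncomputable abbrev chainsInclusion (C : CellComplex K) (R : Type v) [CommRing R]
    {A B : C.Subcomplex} (h : A ≤ B) (q : ℤ) :
    (C.CellsOfDim A q →₀ R) →ₗ[R] (C.CellsOfDim B q →₀ R) :=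
  Finsupp.lmapDomain R R (C.cellsInclusion h q)

theorem chainsInclusion_mem_cycles (C : CellComplex K) (R : Type v) [CommRing R]
    {A B : C.Subcomplex} (h : A ≤ B) {q : ℤ} {z : C.CellsOfDim A q →₀ R} (hz : z ∈ C.cycles R A q) :
    C.chainsInclusion R h q z ∈ C.cycles R B q := by
  have := LinearMap.congr_fun (C.boundary_lmapDomain R h q (q - 1)) z
  rw [LinearMap.comp_apply, LinearMap.comp_apply, LinearMap.mem_ker.mp hz, map_zero] at this
  exact this

theorem boundary_mem_cycles (C : CellComplex K) (R : Type v) [CommRing R]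
    {A : C.Subcomplex} {q : ℤ} (y : C.CellsOfDim A (q + 1) →₀ R) :
    C.boundary R A (q + 1) q y ∈ C.cycles R A q :=
  LinearMap.congr_fun (C.boundary_comp_boundary R A (q + 1) q (q - 1) rfl) y

theorem cellsInclusion_injective (C : CellComplex K) {A B : C.Subcomplex} (h : A ≤ B) (q : ℤ) :
    Function.Injective (C.cellsInclusion h q) :=
  fun _ _ hab => Subtype.ext (congrArg (fun x => x.1) hab)

/-- Turns membership in the image into an equation between chains, which can be carried from one
coefficient ring to another. -/
theorem homologyClass_mem_range_iff (C : CellComplex K) (R : Type v) [CommRing R]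
    {A B : C.Subcomplex} (h : A ≤ B) (q : ℤ) (z : C.cycles R B q) :
    C.homologyClass R B q z ∈ LinearMap.range (C.homologyMap R h q).hom ↔
      ∃ a ∈ C.cycles R A q, ∃ y, z.1 = C.chainsInclusion R h q a + C.boundary R B (q + 1) q y := by
  have hnat : ∀ a : C.cycles R A q, (C.homologyMap R h q).hom (C.homologyClass R A q a) =
      C.homologyClass R B q ⟨_, C.chainsInclusion_mem_cycles R h a.2⟩ := fun a =>
    HomologicalComplex.homologyMap_homologyClass (C.chainsMap R h) q (q - 1)
      (ChainComplex.next _ _) a ⟨_, C.chainsInclusion_mem_cycles R h a.2⟩ rfl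
  constructor
  · rintro ⟨x, hx⟩
    obtain ⟨a, rfl⟩ := C.homologyClass_surjective R A q x
    rw [hnat, eq_comm, ← sub_eq_zero, ← map_sub, homologyClass_eq_zero_iff] at hx
    obtain ⟨y, hy⟩ := hx
    exact ⟨a.1, a.2, y, by rw [hy]; simp⟩
  · rintro ⟨a, ha, y, hy⟩
    refine ⟨C.homologyClass R A q ⟨a, ha⟩, ?_⟩
    rw [hnat, eq_comm, ← sub_eq_zero, ← map_sub, homologyClass_eq_zero_iff]
    exact ⟨y, by simp [hy]⟩

/-! ### Change of coefficients from `ℤ` to `ℚ` and `ℤ/p` -/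

/-- Extension of coefficients from `ℤ`. -/
noncomputable def intCastChains (C : CellComplex K) (R : Type v) [CommRing R] (A : C.Subcomplex)
    (q : ℤ) : (C.CellsOfDim A q →₀ ℤ) →+ (C.CellsOfDim A q →₀ R) :=
  Finsupp.mapRange.addMonoidHom (Int.castAddHom R)

@[simp]
theorem intCastChains_apply (C : CellComplex K) (R : Type v) [CommRing R] (A : C.Subcomplex)
    (q : ℤ) (x : C.CellsOfDim A q →₀ ℤ) (σ : C.CellsOfDim A q) :
    C.intCastChains R A q x σ = (x σ : R) := rfl

theorem boundary_intCastChains (C : CellComplex K) (R : Type v) [CommRing R] (A : C.Subcomplex)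
    (i j : ℤ) (x : C.CellsOfDim A i →₀ ℤ) :
    C.boundary R A i j (C.intCastChains R A i x) =
      C.intCastChains R A j (C.boundary ℤ A i j x) := by
  induction x using Finsupp.induction_linear with
  | zero => simp
  | add x y hx hy => simp only [map_add, hx, hy]
  | single σ n =>
    have : C.intCastChains R A i (Finsupp.single σ n) = Finsupp.single σ (n : R) := by
      simp [intCastChains]
    ext τ
    rw [this, boundary_single_apply, intCastChains_apply, boundary_single_apply]
    simp

theorem chainsInclusion_intCastChains (C : CellComplex K) (R : Type v) [CommRing R]
    {A B : C.Subcomplex} (h : A ≤ B) (q : ℤ) (x : C.CellsOfDim A q →₀ ℤ) :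
    C.chainsInclusion R h q (C.intCastChains R A q x) =
      C.intCastChains R B q (C.chainsInclusion ℤ h q x) := by
  induction x using Finsupp.induction_linear with
  | zero => simp
  | add x y hx hy => simp only [map_add, hx, hy]
  | single σ n => simp [intCastChains]

theorem intCastChains_mem_cycles (C : CellComplex K) (R : Type v) [CommRing R] {A : C.Subcomplex}
    {q : ℤ} {x : C.CellsOfDim A q →₀ ℤ} (hx : x ∈ C.cycles ℤ A q) :
    C.intCastChains R A q x ∈ C.cycles R A q := by
  rw [LinearMap.mem_ker, boundary_intCastChains, LinearMap.mem_ker.mp hx, map_zero]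

/-- Extension of coefficients from `ℤ`, on cycles. -/
noncomputable def intCastCycles (C : CellComplex K) (R : Type v) [CommRing R] (A : C.Subcomplex)
    (q : ℤ) : C.cycles ℤ A q →+ C.cycles R A q where
  toFun x := ⟨C.intCastChains R A q x.1, C.intCastChains_mem_cycles R x.2⟩
  map_zero' := Subtype.ext (map_zero _)
  map_add' _ _ := Subtype.ext (map_add _ _ _)

theorem intCastChains_zmod_surjective (C : CellComplex K) (p : ℕ) (A : C.Subcomplex) (q : ℤ) :
    Function.Surjective (C.intCastChains (ZMod p) A q) := fun x =>
  ⟨Finsupp.equivFunOnFinite.symm fun σ => (x σ).cast, by ext; simp⟩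

theorem exists_eq_smul_of_intCastChains_zmod_eq_zero (C : CellComplex K) {p : ℕ}
    {A : C.Subcomplex} {q : ℤ} {x : C.CellsOfDim A q →₀ ℤ}
    (hx : C.intCastChains (ZMod p) A q x = 0) : ∃ y, x = (p : ℤ) • y := by
  have h : ∀ σ, (p : ℤ) ∣ x σ := fun σ =>
    (ZMod.intCast_zmod_eq_zero_iff_dvd _ _).mp (by simpa using DFunLike.congr_fun hx σ)
  choose y hy using h
  exact ⟨Finsupp.equivFunOnFinite.symm y, by ext σ; simpa using hy σ⟩

/-- Cycles modulo `p` lift to integral cycles if the homology in one dimension less is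
torsion-free. -/
theorem intCastCycles_zmod_surjective (C : CellComplex K) {p : ℕ} (hp : p ≠ 0) {A : C.Subcomplex}
    {q : ℤ} (hA : Module.IsTorsionFree ℤ (C.homology ℤ A (q - 1))) :
    Function.Surjective (C.intCastCycles (ZMod p) A q) := by
  rintro ⟨z, hz⟩
  have hp' : (p : ℤ) ≠ 0 := by exact_mod_cast hp
  obtain ⟨x, rfl⟩ := C.intCastChains_zmod_surjective p A q z
  rw [LinearMap.mem_ker, boundary_intCastChains] at hz
  obtain ⟨w, hw⟩ := C.exists_eq_smul_of_intCastChains_zmod_eq_zero hz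
  -- Since `p w = ∂x`, also `p ∂w = 0`, and chains are torsion-free.
  have hwc : w ∈ C.cycles ℤ A (q - 1) := by
    have := LinearMap.congr_fun
      (C.boundary_comp_boundary ℤ A q (q - 1) (q - 1 - 1) (by ring)) x
    rw [LinearMap.comp_apply, hw, map_smul] at this
    exact (smul_eq_zero.mp this).resolve_left hp'
  -- `p [w] = [∂x] = 0`, so `w` is itself a boundary `∂y`; then `x - p y` is a cycle with the same
  -- reduction as `x`.
  have hcl : C.homologyClass ℤ A (q - 1) ⟨w, hwc⟩ = 0 := by
    refine LinearMap.eq_zero_of_map_smul_eq_zero _ hp' ?_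
    refine (C.homologyClass_eq_zero_iff ℤ A (q - 1) _).mpr ?_
    rw [sub_add_cancel]
    exact ⟨x, hw⟩
  rw [homologyClass_eq_zero_iff, sub_add_cancel] at hcl
  obtain ⟨y, hy⟩ := hcl
  refine ⟨⟨x - (p : ℤ) • y, ?_⟩, Subtype.ext ?_⟩
  · rw [LinearMap.mem_ker, map_sub, map_smul, hy, hw, sub_self]
  · ext σ
    simp [intCastCycles]

/-- Clears the denominators of the finitely many coefficients; the cycle condition descends since `ℤ
→ ℚ` is injective. -/
theorem exists_smul_eq_intCastCycles_rat (C : CellComplex K) {A : C.Subcomplex} {q : ℤ}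
    (z : C.cycles ℚ A q) : ∃ n : ℤ, n ≠ 0 ∧ ∃ x, C.intCastCycles ℚ A q x = (n : ℚ) • z := by
  obtain ⟨n, hn⟩ := IsLocalization.exist_integer_multiples_of_finite (nonZeroDivisors ℤ) z.1
  choose x hx using hn
  have h1 : C.intCastChains ℚ A q (Finsupp.equivFunOnFinite.symm x) = ((n : ℤ) : ℚ) • z.1 := by
    ext σ
    simpa using hx σ
  refine ⟨n, nonZeroDivisors.ne_zero n.2, ⟨Finsupp.equivFunOnFinite.symm x, ?_⟩, Subtype.ext h1⟩
  have h2 := C.boundary_intCastChains ℚ A q (q - 1) (Finsupp.equivFunOnFinite.symm x)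
  rw [h1, map_smul, LinearMap.mem_ker.mp z.2, smul_zero] at h2
  ext σ
  simpa using (DFunLike.congr_fun h2 σ).symm

end CellComplex

/-! ### Excluding `p`-torsion by comparing dimensions -/

/-- A criterion for `N / M` to have no `p`-torsion: its rank is at least the dimension of its
reduction modulo `p`. -/
theorem mem_of_prime_smul_mem {N : Type*} [AddCommGroup N] [Module.Finite ℤ N] (M : Submodule ℤ N)
    (p : ℕ) [Fact p.Prime]
    {V : Type*} [AddCommGroup V] [Module ℚ V] {W : Type*} [AddCommGroup W] [Module (ZMod p) W]
    (g : N →+ V) (h : N →+ W) (hg : ∀ x ∈ M, g x = 0)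
    (hspan : Submodule.span ℚ (Set.range g) = ⊤) (hsurj : Function.Surjective h)
    (hker : ∀ x, h x = 0 → ∃ m ∈ M, ∃ y, x = m + (p : ℤ) • y)
    [Module.Finite (ZMod p) W] (hrank : Module.finrank ℚ V = Module.finrank (ZMod p) W)
    (x : N) (hx : (p : ℤ) • x ∈ M) : x ∈ M := by
  classical
  set c := Module.finrank (ZMod p) W with hc
  let b : Module.Basis (Fin c) (ZMod p) W := Module.finBasis (ZMod p) W
  choose y hy using fun i => hsurj (b i)
  set Y : Submodule ℤ N := Submodule.span ℤ (Set.range y) with hY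
  -- `N = M + Y + pN`: subtract the integral lift of the coordinates of `h x`; the remainder lies in
  -- `ker h`.
  have hcover : ∀ x : N, ∃ m ∈ M ⊔ Y, ∃ z, x = m + (p : ℤ) • z := by
    intro x
    let a : Fin c → ℤ := fun i => (b.repr (h x) i).val
    have h1 : h (x - ∑ i, a i • y i) = 0 := by
      rw [map_sub, map_sum, sub_eq_zero]
      conv_lhs => rw [← b.sum_repr (h x)]
      refine Finset.sum_congr rfl fun i _ => ?_
      rw [map_zsmul, hy, ← Int.cast_smul_eq_zsmul (ZMod p)]
      simp [a]
    obtain ⟨m, hm, z, hz⟩ := hker _ h1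
    refine ⟨m + ∑ i, a i • y i, ?_, z, ?_⟩
    · exact Submodule.add_mem_sup hm
        (Submodule.sum_mem _ fun i _ => Submodule.smul_mem _ _ (Submodule.subset_span ⟨i, rfl⟩))
    · rw [add_right_comm, ← hz, sub_add_cancel]
  -- Nakayama's lemma for `N / (M + Y)`, which equals `p` times itself: some `n ≡ 1 mod p`
  -- annihilates it.
  obtain ⟨n, hn, hnN⟩ : ∃ n : ℤ, (p : ℤ) ∣ n - 1 ∧ ∀ x : N, n • x ∈ M ⊔ Y := by
    have key := Submodule.exists_sub_one_mem_and_smul_eq_zero_of_fg_of_le_smul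
      (Ideal.span {(p : ℤ)}) (⊤ : Submodule ℤ (N ⧸ (M ⊔ Y))) Module.Finite.fg_top ?_
    · obtain ⟨n, hn, hn0⟩ := key
      refine ⟨n, Ideal.mem_span_singleton.mp hn, fun x => ?_⟩
      have := hn0 (Submodule.Quotient.mk x) trivial
      rwa [← Submodule.Quotient.mk_smul, Submodule.Quotient.mk_eq_zero] at this
    · rintro w -
      obtain ⟨x, rfl⟩ := Submodule.Quotient.mk_surjective _ w
      obtain ⟨m, hm, z, rfl⟩ := hcover x
      rw [Submodule.Quotient.mk_add, (Submodule.Quotient.mk_eq_zero _).mpr hm, zero_add,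
        Submodule.Quotient.mk_smul]
      exact Submodule.smul_mem_smul (Ideal.mem_span_singleton_self _) trivial
  have hdecomp : ∀ x : N, ∃ m ∈ M, ∃ a : Fin c → ℤ, n • x = m + ∑ i, a i • y i := by
    intro x
    obtain ⟨m, hm, z, hz, hmz⟩ := Submodule.mem_sup.mp (hnN x)
    obtain ⟨a, ha⟩ := (Submodule.mem_span_range_iff_exists_fun ℤ).mp hz
    exact ⟨m, hm, a, by rw [ha, hmz]⟩
  have hn0 : (n : ℚ) ≠ 0 := by
    rintro h0
    rw [Int.cast_eq_zero] at h0
    subst h0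
    rw [zero_sub, dvd_neg] at hn
    exact (Fact.out : p.Prime).one_lt.ne' (by simpa using Int.isUnit_iff_natAbs_eq.mp (isUnit_of_dvd_one hn))
  -- Rationally `n` is invertible and `M` dies, so the `c` vectors `g (y i)` span `V`; as `dim V =
  -- c`, they are independent.
  have hspan' : ⊤ ≤ Submodule.span ℚ (Set.range fun i => g (y i)) := by
    rw [← hspan, Submodule.span_le]
    rintro _ ⟨x, rfl⟩
    obtain ⟨m, hm, a, ha⟩ := hdecomp x
    have h1 : (n : ℚ) • g x = ∑ i, (a i : ℚ) • g (y i) := by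
      simpa [hg m hm, Int.cast_smul_eq_zsmul] using congrArg g ha
    rw [SetLike.mem_coe, ← Submodule.smul_mem_iff _ hn0, h1]
    exact Submodule.sum_mem _ fun i _ => Submodule.smul_mem _ _ (Submodule.subset_span ⟨i, rfl⟩)
  have hli := linearIndependent_of_top_le_span_of_card_eq_finrank hspan' (by simp [hrank])
  obtain ⟨m, hm, a, ha⟩ := hdecomp x
  have hp0 : (p : ℚ) ≠ 0 := Nat.cast_ne_zero.mpr (Fact.out : p.Prime).ne_zero
  -- Apply `g` to `n p x ∈ M`. Independence then forces every `a i = 0`, so `n x ∈ M`, and `n ≡ 1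
  -- mod p` with `p x ∈ M` gives `x ∈ M`.
  have h1 : ∑ i, ((p : ℚ) * a i) • g (y i) = 0 := by
    have h2 : g (n • (p : ℤ) • x) = 0 := hg _ (M.smul_mem n hx)
    rw [smul_comm, ha, map_zsmul, map_add, hg m hm, zero_add, map_sum,
      ← Int.cast_smul_eq_zsmul ℚ, Finset.smul_sum] at h2
    simpa [mul_smul, Int.cast_smul_eq_zsmul] using h2
  have ha0 : ∀ i, a i = 0 := fun i => by
    simpa [hp0] using Fintype.linearIndependent_iff.mp hli _ h1 i
  have hnx : n • x ∈ M := by simpa [ha, ha0] using hm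
  obtain ⟨k, hk⟩ := hn
  have : x = n • x - k • (p : ℤ) • x := by
    rw [smul_smul, mul_comm k, ← hk, sub_smul, one_smul, sub_sub_cancel]
  rw [this]
  exact M.sub_mem hnx (M.smul_mem k hx)

/-! ### Reading cokernel dimensions off the diagram -/

/-- The dimension of the space at time `t` of an interval module modulo the image of the
structure map from time `s`. -/
noncomputable def intervalCorank (k : Type v) [Field k] {T : Type w} [LinearOrder T] (s t : T)
    (i : T × WithTop T) : ℕ :=
  Module.finrank k (intervalSpace k i.1 i.2 t ⧸ LinearMap.range (intervalMap k i.1 i.2 s t))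

open Classical in
-- An interval alive at `t` is hit from time `s` exactly when it was already born at `s`. The value
-- does not depend on `k`.
theorem intervalCorank_eq (k : Type v) [Field k] {T : Type w} [LinearOrder T] {s t : T}
    (hst : s ≤ t) (i : T × WithTop T) :
    intervalCorank k s t i = if (i.1 ≤ t ∧ (t : WithTop T) < i.2) ∧ ¬ i.1 ≤ s then 1 else 0 := by
  obtain ⟨b, d⟩ := i
  unfold intervalCorank
  dsimp only
  by_cases h : b ≤ t ∧ (t : WithTop T) < d
  · by_cases hs : b ≤ s
    · have hr : LinearMap.range (intervalMap k b d s t) = ⊤ := by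
        rw [intervalMap, dif_pos ⟨hs, hst, h.2⟩, LinearMap.range_eq_top]
        rintro ⟨x, hx⟩
        refine ⟨⟨x, ?_⟩, rfl⟩
        rw [intervalSpace, if_pos ⟨hs, (WithTop.coe_le_coe.mpr hst).trans_lt h.2⟩]
        trivial
      rw [hr]
      simp [hs, Module.finrank_zero_of_subsingleton]
    · have hr : LinearMap.range (intervalMap k b d s t) = ⊥ := by
        rw [intervalMap, dif_neg (fun h' => hs h'.1), LinearMap.range_zero]
      rw [hr, (Submodule.quotEquivOfEqBot _ rfl).finrank_eq, intervalSpace, if_pos h, finrank_top,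
        Module.finrank_self, if_pos ⟨h, hs⟩]
  · rw [if_neg (fun h' => h h'.1)]
    have : Subsingleton (intervalSpace k b d t) := by
      rw [intervalSpace, if_neg h]
      infer_instance
    exact Module.finrank_zero_of_subsingleton

namespace CellComplex

variable {K : Type u} [Fintype K]

/-- The cokernel of the map `H_q(A; R) → H_q(B; R)` induced by an inclusion. -/
abbrev homologyCoker (C : CellComplex K) (R : Type v) [CommRing R] {A B : C.Subcomplex}
    (h : A ≤ B) (q : ℤ) : Type (max u v) :=
  C.homology R B q ⧸ LinearMap.range (C.homologyMap R h q).hom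

open Classical in
theorem IsPersistenceDiagram.finrank_homologyCoker {C : CellComplex K} {T : Type w} [LinearOrder T]
    [OrderBot T] {F : C.Filtration T} {q : ℤ} {k : Type v} [Field k] {D : Multiset (T × WithTop T)}
    (hD : IsPersistenceDiagram F q k D) {s t : T} (hst : s ≤ t) :
    Module.finrank k (C.homologyCoker k (F.mono hst) q) =
      (D.map fun i => if (i.1 ≤ t ∧ (t : WithTop T) < i.2) ∧ ¬ i.1 ≤ s then 1 else 0).sum := by
  obtain ⟨L, b, d, rfl, -, e, he⟩ := hD
  let P : ∀ i, Submodule k (intervalSpace k (b i) (d i) t) :=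
    fun i => LinearMap.range (intervalMap k (b i) (d i) s t)
  -- The isomorphism at time `t` carries the image to the product of the images in the summands, so
  -- the cokernel splits.
  have hmap : (LinearMap.range (C.homologyMap k (F.mono hst) q).hom).map (e t).toLinearMap =
      Submodule.pi Set.univ P := by
    ext y
    simp only [Submodule.mem_map, LinearMap.mem_range, Submodule.mem_pi, Set.mem_univ, true_imp_iff,
      P]
    constructor
    · rintro ⟨_, ⟨x, rfl⟩, rfl⟩ i
      exact ⟨e s x i, (he s t hst x i).symm⟩
    · intro h
      choose z hz using h
      refine ⟨_, ⟨(e s).symm z, rfl⟩, funext fun i => ?_⟩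
      rw [LinearEquiv.coe_coe, he s t hst, LinearEquiv.apply_symm_apply, hz]
  rw [(Submodule.Quotient.equiv _ _ (e t) hmap).finrank_eq, (Submodule.quotientPi P).finrank_eq,
    Module.finrank_pi_fintype, Multiset.map_map]
  exact Finset.sum_congr rfl fun i _ => intervalCorank_eq k hst (b i, d i)

end CellComplex

/-! ### From field coefficients to freeness of relative homology -/

theorem Module.isTorsionFree_of_range_eq_ker {R L M N P : Type*} [CommRing R] [IsDomain R]
    [AddCommGroup L] [Module R L] [AddCommGroup M] [Module R M] [AddCommGroup N] [Module R N]
    [AddCommGroup P] [Module R P] [Module.IsTorsionFree R P]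
    (f : L →ₗ[R] M) (g : M →ₗ[R] N) (d : N →ₗ[R] P) (hfg : LinearMap.range f = LinearMap.ker g)
    (hgd : LinearMap.range g = LinearMap.ker d)
    (hf : ∀ r : R, r ≠ 0 → ∀ x, r • x ∈ LinearMap.range f → x ∈ LinearMap.range f) :
    Module.IsTorsionFree R N := by
  refine .of_smul_eq_zero fun r x hx => or_iff_not_imp_left.mpr fun hr => ?_
  have hd : x ∈ LinearMap.ker d :=
    LinearMap.eq_zero_of_map_smul_eq_zero _ hr (by rw [hx, map_zero])
  rw [← hgd] at hd
  obtain ⟨y, rfl⟩ := hd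
  rw [← map_smul, ← LinearMap.mem_ker, ← hfg] at hx
  rw [← LinearMap.mem_ker, ← hfg]
  exact hf r hr y hx

namespace CellComplex

variable {K : Type u} [Fintype K]

/-- The class of a cycle in the cokernel of the map induced by an inclusion. -/
noncomputable def cokerClass (C : CellComplex K) (R : Type v) [CommRing R] {A B : C.Subcomplex}
    (h : A ≤ B) (q : ℤ) : C.cycles R B q →ₗ[R] C.homologyCoker R h q :=
  (LinearMap.range (C.homologyMap R h q).hom).mkQ ∘ₗ C.homologyClass R B q

theorem cokerClass_surjective (C : CellComplex K) (R : Type v) [CommRing R] {A B : C.Subcomplex}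
    (h : A ≤ B) (q : ℤ) : Function.Surjective (C.cokerClass R h q) :=
  (Submodule.mkQ_surjective _).comp (C.homologyClass_surjective R B q)

theorem cokerClass_eq_zero_iff (C : CellComplex K) (R : Type v) [CommRing R] {A B : C.Subcomplex}
    (h : A ≤ B) (q : ℤ) (z : C.cycles R B q) : C.cokerClass R h q z = 0 ↔
      ∃ a ∈ C.cycles R A q, ∃ y, z.1 = C.chainsInclusion R h q a + C.boundary R B (q + 1) q y := by
  rw [← homologyClass_mem_range_iff, cokerClass, LinearMap.comp_apply, Submodule.mkQ_apply,
    Submodule.Quotient.mk_eq_zero]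

/-- If the cokernels of `H_q(A; k) → H_q(B; k)` have the same dimension for `k = ℚ` and
`k = ℤ/p`, then the cokernel of `H_q(A; ℤ) → H_q(B; ℤ)` has no `p`-torsion. -/
theorem homologyClass_mem_range_of_prime_smul (C : CellComplex K) {A B : C.Subcomplex} (h : A ≤ B)
    (q : ℤ) (p : ℕ) [Fact p.Prime]
    (hA : Module.IsTorsionFree ℤ (C.homology ℤ A (q - 1)))
    (hB : Module.IsTorsionFree ℤ (C.homology ℤ B (q - 1)))
    (hrank : Module.finrank ℚ (C.homologyCoker ℚ h q) =
      Module.finrank (ZMod p) (C.homologyCoker (ZMod p) h q))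
    (z : C.cycles ℤ B q) (hz : C.homologyClass ℤ B q ((p : ℤ) • z) ∈
      LinearMap.range (C.homologyMap ℤ h q).hom) :
    C.homologyClass ℤ B q z ∈ LinearMap.range (C.homologyMap ℤ h q).hom := by
  have hp : (p : ℤ) ≠ 0 := by exact_mod_cast (Fact.out : p.Prime).ne_zero
  have : Module.Finite (ZMod p) (C.homologyCoker (ZMod p) h q) :=
    Module.Finite.of_surjective _ (C.cokerClass_surjective (ZMod p) h q)
  -- Here `N` is the group of integral cycles of `B`, `M` those whose class comes from `A`, and `V`,
  -- `W` are the cokernels over `ℚ` and `ℤ/p`.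
  refine mem_of_prime_smul_mem
    ((LinearMap.range (C.homologyMap ℤ h q).hom).comap (C.homologyClass ℤ B q)) p
    ((C.cokerClass ℚ h q).toAddMonoidHom.comp (C.intCastCycles ℚ B q))
    ((C.cokerClass (ZMod p) h q).toAddMonoidHom.comp (C.intCastCycles (ZMod p) B q))
    ?_ ?_ ?_ ?_ hrank z hz
  · intro x hx
    obtain ⟨a, ha, y, hy⟩ := (C.homologyClass_mem_range_iff ℤ h q x).mp hx
    refine (C.cokerClass_eq_zero_iff ℚ h q _).mpr ⟨_, C.intCastChains_mem_cycles ℚ ha,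
      C.intCastChains ℚ B _ y, ?_⟩
    rw [chainsInclusion_intCastChains, boundary_intCastChains, ← map_add, ← hy]
    rfl
  · rw [eq_top_iff]
    rintro w -
    obtain ⟨z, rfl⟩ := C.cokerClass_surjective ℚ h q w
    obtain ⟨n, hn, x, hx⟩ := C.exists_smul_eq_intCastCycles_rat z
    rw [← Submodule.smul_mem_iff _ (Int.cast_ne_zero.mpr hn : (n : ℚ) ≠ 0), ← map_smul, ← hx]
    exact Submodule.subset_span ⟨x, rfl⟩
  · exact (C.cokerClass_surjective (ZMod p) h q).comp
      (C.intCastCycles_zmod_surjective (Fact.out : p.Prime).ne_zero hB)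
  · intro x hx
    obtain ⟨a, ha, y, hy⟩ := (C.cokerClass_eq_zero_iff (ZMod p) h q _).mp hx
    -- Lift the cycle of `A` and the bounding chain to `ℤ`; they give `m ∈ M` with `x - m` divisible
    -- by `p` as a chain.
    obtain ⟨a', ha'⟩ := C.intCastCycles_zmod_surjective (Fact.out : p.Prime).ne_zero hA ⟨a, ha⟩
    obtain rfl : C.intCastChains (ZMod p) A q a'.1 = a := congrArg Subtype.val ha'
    obtain ⟨y', rfl⟩ := C.intCastChains_zmod_surjective p B _ y
    rw [chainsInclusion_intCastChains, boundary_intCastChains, ← map_add] at hy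
    set m : C.cycles ℤ B q :=
      ⟨_, Submodule.add_mem _ (C.chainsInclusion_mem_cycles ℤ h a'.2)
        (C.boundary_mem_cycles ℤ y')⟩ with hm
    have h0 : C.intCastChains (ZMod p) B q (x.1 - m.1) = 0 := by
      rw [map_sub, sub_eq_zero]
      exact hy
    obtain ⟨w, hw⟩ := C.exists_eq_smul_of_intCastChains_zmod_eq_zero h0
    -- The quotient must be a cycle, not just a chain: `p w` is one, and chains are torsion-free.
    have hwc : w ∈ C.cycles ℤ B q := by
      have h1 : (p : ℤ) • w ∈ C.cycles ℤ B q := hw ▸ Submodule.sub_mem _ x.2 m.2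
      exact LinearMap.eq_zero_of_map_smul_eq_zero _ hp h1
    refine ⟨m, (C.homologyClass_mem_range_iff ℤ h q m).mpr ⟨a'.1, a'.2, y', rfl⟩, ⟨w, hwc⟩, ?_⟩
    exact Subtype.ext (sub_eq_iff_eq_add'.mp hw)

theorem mem_range_homologyMap_of_smul (C : CellComplex K) {A B : C.Subcomplex} (h : A ≤ B)
    (q : ℤ) (hA : Module.IsTorsionFree ℤ (C.homology ℤ A (q - 1)))
    (hB : Module.IsTorsionFree ℤ (C.homology ℤ B (q - 1)))
    (hrank : ∀ (p : ℕ) [Fact p.Prime], Module.finrank ℚ (C.homologyCoker ℚ h q) =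
      Module.finrank (ZMod p) (C.homologyCoker (ZMod p) h q))
    {n : ℕ} (hn : n ≠ 0) (z : C.cycles ℤ B q)
    (hz : C.homologyClass ℤ B q ((n : ℤ) • z) ∈ LinearMap.range (C.homologyMap ℤ h q).hom) :
    C.homologyClass ℤ B q z ∈ LinearMap.range (C.homologyMap ℤ h q).hom := by
  induction n using Nat.recOnMul generalizing z with
  | zero => exact (hn rfl).elim
  | one => simpa using hz
  | prime p hp =>
    have := Fact.mk hp
    exact C.homologyClass_mem_range_of_prime_smul h q p hA hB (hrank p) z hz
  | mul a b iha ihb =>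
    rw [Nat.cast_mul, mul_smul] at hz
    exact ihb (right_ne_zero_of_mul hn) _ (iha (left_ne_zero_of_mul hn) _ hz)

theorem shortExact_cokernel_chainsMap (C : CellComplex K) (R : Type v) [CommRing R]
    {A B : C.Subcomplex} (h : A ≤ B) :
    (ShortComplex.mk (C.chainsMap R h) (cokernel.π (C.chainsMap R h))
      (cokernel.condition _)).ShortExact := by
  have : Mono (C.chainsMap R h) := by
    have (q : ℤ) : Mono ((C.chainsMap R h).f q) := (ModuleCat.mono_iff_injective _).mpr
      (Finsupp.mapDomain_injective (C.cellsInclusion_injective h q))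
    exact HomologicalComplex.mono_of_mono_f _ this
  exact ShortComplex.ShortExact.mk (ShortComplex.exact_cokernel _)

/-- The relative homology is free if the cokernel of `H_q(A) → H_q(B)` and `H_{q-1}(A)`
are torsion-free. -/
theorem free_relativeHomology (C : CellComplex K) {A B : C.Subcomplex} (h : A ≤ B)
    (q : ℤ) (hA : Module.IsTorsionFree ℤ (C.homology ℤ A (q - 1)))
    (hcoker : ∀ n : ℕ, n ≠ 0 → ∀ z : C.cycles ℤ B q,
      C.homologyClass ℤ B q ((n : ℤ) • z) ∈ LinearMap.range (C.homologyMap ℤ h q).hom →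
      C.homologyClass ℤ B q z ∈ LinearMap.range (C.homologyMap ℤ h q).hom) :
    Module.Free ℤ (C.relativeHomology ℤ h q) := by
  have hS := C.shortExact_cokernel_chainsMap ℤ h
  have hrel : (ComplexShape.down ℤ).Rel q (q - 1) := by simp
  have ex₂ := (hS.homology_exact₂ q).moduleCat_range_eq_ker
  have ex₃ := (hS.homology_exact₃ q (q - 1) hrel).moduleCat_range_eq_ker
  have := C.finite_homology ℤ B q
  have := C.finite_homology ℤ A (q - 1)
  -- Exactness between two finitely generated groups; over `ℤ`, finitely generated and torsion-free
  -- then implies free.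
  have : IsNoetherian ℤ (C.relativeHomology ℤ h q) := isNoetherian_of_range_eq_ker _ _ ex₃
  have : Module.IsTorsionFree ℤ (C.relativeHomology ℤ h q) := by
    refine Module.isTorsionFree_of_range_eq_ker _ _ _ ex₂ ex₃ fun n hn x hx => ?_
    obtain ⟨z, rfl⟩ := C.homologyClass_surjective ℤ B q x
    refine hcoker n.natAbs (by simpa using hn) z ?_
    rw [← LinearMap.map_smul] at hx
    rcases Int.natAbs_eq n with hn' | hn'
    · rwa [← hn']
    · rw [hn', neg_smul, map_neg] at hx
      exact neg_mem_iff.mp hx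
  infer_instance

end CellComplex

theorem theorem2 {K : Type u} [Fintype K] (C : CellComplex K)
    {T : Type w} [LinearOrder T] [OrderBot T] (F : C.Filtration T) (q : ℤ)
    (hD : CellComplex.DiagramIndependentOfField F q)
    (hfree : ∀ n : T, Module.Free ℤ (C.homology ℤ (F.X n) (q - 1))) :
    ∀ (m n : T) (hmn : m < n),
      Module.Free ℤ (C.relativeHomology ℤ (F.mono hmn.le) q) := by
  intro m n hmn
  obtain ⟨D, -, -, hQ, hp⟩ := hD
  have hfree' (t : T) : Module.IsTorsionFree ℤ (C.homology ℤ (F.X t) (q - 1)) := by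
    have := hfree t
    infer_instance
  refine C.free_relativeHomology _ q (hfree' m)
    fun _ => C.mem_range_homologyMap_of_smul _ q (hfree' m) (hfree' n) fun p _ => ?_
  rw [hQ.finrank_homologyCoker hmn.le, (hp p).finrank_homologyCoker hmn.le]
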